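/- Let $g=(g_p)_{p\ge 1}$ be complex numbers, $V(x)=-\sum_{p\ge 1}\frac1p g_p x^p$ as a formal power series, and for $N\ge 1$ let $$d\mu_0(M)=\Big(\frac N\pi\Big)^{N^2}e^{-N\,\mathrm{Tr}(M^\dagger M)}\,dM$$ be the normalized Gaussian measure on complex $N\times N$ matrices ($dM$ is Lebesgue measure on $\mathbb C^{N\times N}\cong\mathbb R^{2N^2}$). For a function $f$ of $M$ let $$\langle f(M)\rangle=\int f(M)\,e^{-N\,\mathrm{Tr}\,V(\alpha M^\dagger M)}\,d\mu_0(M)\in\mathbb C[[\alpha]],$$ where the exponential is expanded in powers of $\alpha$ and integrated term by term; and put $$d_{p;(N)}=\frac1N\,\frac{\langle \mathrm{Tr}[(M^\dagger M)^p]\rangle}{\langle 1\rangle}\in\mathbb C[[\alpha]],\qquad p\ge 0 .$$ For $f=\mathrm{Tr}[(M^\dagger M)^p]$, $p\ge 0$, all the integrals converge absolutely, and $\langle 1\rangle$ has constant term $1$. For every $p\ge0$ the limit $d_p=\lim_{N\to\infty}d_{p;(N)}$ exists in $\mathbb C[[\alpha]]$ (coefficientwise convergence), $d_0=1$, and for every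 $q\ge 0$ $$d_{q+1}=\sum_{k=0}^{q}d_k\,d_{q-k}+\sum_{n=1}^{\infty}g_n\,\alpha^n\,d_{q+n},$$ where the infinite series converges coefficientwise in $\mathbb C[[\alpha]]$. -/

import Mathlib

open Filter Topology MeasureTheory
open scoped Matrix PowerSeries.WithPiTopology

noncomputable section

namespace MatrixModel

/-- The complex `N × N` matrices as a space with Lebesgue measure (the product over the `N ^ 2`
entries of the Lebesgue measure of `ℂ = ℝ²`); `Matrix.of` turns an element into a matrix. -/
abbrev Entries (N : ℕ) : Type := Fin N → Fin N → ℂ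

/-- `M† M`. -/
def gram {N : ℕ} (M : Entries N) : Matrix (Fin N) (Fin N) ℂ :=
  (Matrix.of M)ᴴ * Matrix.of M

/-- The normalized Gaussian measure `(N / π) ^ (N ^ 2) * exp (-N Tr (M† M)) dM`: this is the measure
of the model at `α = 0`. -/
def gaussian (N : ℕ) : Measure (Entries N) :=
  volume.withDensity fun M =>
    ENNReal.ofReal (((N : ℝ) / Real.pi) ^ (N ^ 2) * Real.exp (-(N : ℝ) * (gram M).trace.re))

/-- The potential `V(x) = -∑_{p ≥ 1} (1 / p) g_p x ^ p`, a formal power series (the value `g 0` is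
not used). -/
def potential (g : ℕ → ℂ) : PowerSeries ℂ :=
  PowerSeries.mk fun p => if p = 0 then 0 else -(1 / (p : ℂ) * g p)

/-- `Tr V(α M† M)` at a fixed matrix `M`, as a formal power series in `α`. -/
def tracePotential (g : ℕ → ℂ) {N : ℕ} (M : Entries N) : PowerSeries ℂ :=
  PowerSeries.mk fun p => PowerSeries.coeff p (potential g) * (gram M ^ p).trace

/-- The formal power series that is substituted in the exponential in `weight` has no constant
term, so that the substitution is legitimate. -/
theorem hasSubst_tracePotential (g : ℕ → ℂ) {N : ℕ} (M : Entries N) :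
    PowerSeries.HasSubst (-((N : ℂ) • tracePotential g M)) := by
  apply PowerSeries.HasSubst.of_constantCoeff_zero'
  have h : PowerSeries.constantCoeff (tracePotential g M) = 0 := by
    rw [← PowerSeries.coeff_zero_eq_constantCoeff_apply]
    simp [tracePotential, potential, -PowerSeries.coeff_zero_eq_constantCoeff]
  simp [h]

/-- The interaction factor `exp (-N Tr V(α M† M))` at a fixed matrix `M`, as a formal power series
in `α`. -/
def weight (g : ℕ → ℂ) {N : ℕ} (M : Entries N) : PowerSeries ℂ :=
  (PowerSeries.exp ℂ).subst (-((N : ℂ) • tracePotential g M))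

/-- The unnormalized correlation `⟨f⟩ = ∫ f(M) exp (-N Tr V(α M† M)) dμ₀(M)`, as a formal power
series in `α`: the weight is expanded in powers of `α` and integrated term by term against the
Gaussian measure. -/
def correlation (g : ℕ → ℂ) (N : ℕ) (f : Entries N → ℂ) : PowerSeries ℂ :=
  PowerSeries.mk fun s => ∫ M, f M * PowerSeries.coeff s (weight g M) ∂(gaussian N)

/-- The partition function `Z = ⟨1⟩`. -/
def partitionFunction (g : ℕ → ℂ) (N : ℕ) : PowerSeries ℂ :=
  correlation g N fun _ => 1

/-- The coefficient `d_{p;(N)} = (1 / N) ⟨Tr (M† M) ^ p⟩ / ⟨1⟩` of the resolvent at size `N`, as a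
formal power series in `α`. -/
def resolventCoeff (g : ℕ → ℂ) (N p : ℕ) : PowerSeries ℂ :=
  (1 / (N : ℂ)) •
    (correlation g N (fun M => (gram M ^ p).trace) * (partitionFunction g N)⁻¹)

end MatrixModel

end

/-! Gaussian integration by parts along the vector field `M (M†M)^q` gives the Schwinger–Dyson
equations (`schwingerDyson`): the divergence of the field splits into products `Tr (M†M)^k · Tr
(M†M)^(q-k)`, and its action on the interaction produces the potential term. These equations contain
two-trace correlations and do not close on the one-trace ones.

To close them, the quantities `g_(i+1) α^(i+1)` are replaced by independent variables `t_i`. Then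
`∂/∂t_i` inserts `(N/(i+1)) Tr (M†M)^(i+1)`, so a normalized two-trace function is a product of
one-point functions plus `1/N²` times a derivative of a one-point function (`twoPoint_eq`). In the
resulting equations (`onePoint_succ`), give `t_i` degree `i+1`: a coefficient of degree `s` of the
`p`-th one-point function is determined by coefficients for which `p + s` is smaller. Induction on
this weight proves convergence of every coefficient as `N → ∞`; the derivatives converge too, so the
`1/N²` term disappears and large-`N` factorization needs no separate argument.

The substitution `t_i = g_(i+1) α^(i+1)` is an algebra homomorphism (`specialize`) whose
coefficients are finite sums, so it carries both limits and equations to the model;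
`weight_eq_specialize` shows that it recovers the given interaction factor. -/

namespace MatrixModel

/-! ### Mixed moments of one complex Gaussian variable -/

open ComplexConjugate

/-- The density of the centred complex Gaussian measure with `E |z| ^ 2 = 1 / N`. -/
noncomputable def gaussianDensity (N : ℕ) (z : ℂ) : ℝ :=
  (N : ℝ) / Real.pi * Real.exp (-(N : ℝ) * ‖z‖ ^ 2)

theorem gaussianDensity_nonneg (N : ℕ) (z : ℂ) : 0 ≤ gaussianDensity N z := by
  unfold gaussianDensity; positivity

theorem integral_norm_pow_mul_gaussianDensity {N : ℕ} (hN : 0 < N) (k : ℕ) :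
    ∫ z : ℂ, ‖z‖ ^ k * gaussianDensity N z =
      (N : ℝ) * (N : ℝ) ^ (-((k : ℝ) + 2) / 2) * Real.Gamma (((k : ℝ) + 2) / 2) := by
  have hN' : (0 : ℝ) < N := by exact_mod_cast hN
  have h := Complex.integral_rpow_mul_exp_neg_mul_rpow (p := 2) (q := k) (b := N) (by norm_num)
    (by have : (0 : ℝ) ≤ k := by positivity
        linarith) hN'
  have e : ∀ z : ℂ, ‖z‖ ^ k * gaussianDensity N z =
      (N : ℝ) / Real.pi * (‖z‖ ^ (k : ℝ) * Real.exp (-(N : ℝ) * ‖z‖ ^ (2 : ℝ))) := by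
    intro z
    rw [Real.rpow_natCast, Real.rpow_two, gaussianDensity]; ring
  simp_rw [e]
  rw [integral_const_mul, h]
  field_simp

/-- A non-integrable function has Bochner integral `0`, whereas the closed form of this integral is
positive. -/
theorem integrable_norm_pow_mul_gaussianDensity {N : ℕ} (hN : 0 < N) (k : ℕ) :
    Integrable fun z : ℂ => ‖z‖ ^ k * gaussianDensity N z := by
  by_contra h
  have := integral_norm_pow_mul_gaussianDensity hN k
  rw [integral_undef h] at this
  have hN' : (0 : ℝ) < N := by exact_mod_cast hN
  have h2 : 0 < Real.Gamma (((k : ℝ) + 2) / 2) := Real.Gamma_pos_of_pos (by positivity)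
  have h3 : (0 : ℝ) < (N : ℝ) * (N : ℝ) ^ (-((k : ℝ) + 2) / 2) * Real.Gamma (((k : ℝ) + 2) / 2) := by
    positivity
  linarith

/-- The integrand of a mixed moment of the complex Gaussian measure. -/
noncomputable def momentIntegrand (N a b : ℕ) (z : ℂ) : ℂ :=
  (gaussianDensity N z : ℂ) * (z ^ a * conj z ^ b)

theorem integrable_momentIntegrand {N : ℕ} (hN : 0 < N) (a b : ℕ) :
    Integrable (momentIntegrand N a b) := by
  refine (integrable_norm_pow_mul_gaussianDensity hN (a + b)).mono' ?_ ?_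
  · refine Continuous.aestronglyMeasurable ?_
    unfold momentIntegrand gaussianDensity
    fun_prop
  · refine .of_forall fun z => le_of_eq ?_
    rw [momentIntegrand, norm_mul, norm_mul, norm_pow, norm_pow, RCLike.norm_conj,
      Complex.norm_real, Real.norm_of_nonneg (gaussianDensity_nonneg N z)]
    ring

theorem integral_momentIntegrand_self {N : ℕ} (hN : 0 < N) (a : ℕ) :
    ∫ z, momentIntegrand N a a z = (a.factorial : ℂ) / (N : ℂ) ^ a := by
  have hN' : (0 : ℝ) < N := by exact_mod_cast hN
  have e : ∀ z : ℂ, momentIntegrand N a a z =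
      ((‖z‖ ^ (2 * a) * gaussianDensity N z : ℝ) : ℂ) := by
    intro z
    rw [momentIntegrand, ← mul_pow, Complex.mul_conj, Complex.normSq_eq_norm_sq]
    push_cast; ring
  simp_rw [e]
  rw [integral_complex_ofReal, integral_norm_pow_mul_gaussianDensity hN]
  have h1 : (((2 * a : ℕ) : ℝ) + 2) / 2 = (a : ℝ) + 1 := by push_cast; ring
  rw [neg_div, h1, Real.Gamma_nat_eq_factorial, Real.rpow_neg hN'.le]
  have h2 : (N : ℝ) ^ ((a : ℝ) + 1) = (N : ℝ) ^ (a + 1) := by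
    rw [← Real.rpow_natCast]; push_cast; rfl
  rw [h2]
  push_cast
  have : (N : ℂ) ≠ 0 := by exact_mod_cast hN.ne'
  field_simp
  ring

/-- A rotation preserves Lebesgue measure and the density. The angle `π / (a - b)` makes `u^a * conj
u^b = -1`, so the integral equals its own negative. -/
theorem integral_momentIntegrand_of_ne (N : ℕ) {a b : ℕ} (h : a ≠ b) :
    ∫ z, momentIntegrand N a b z = 0 := by
  set u : Circle := Circle.exp (Real.pi / ((a : ℝ) - b)) with hu
  have hab : (a : ℝ) - b ≠ 0 := sub_ne_zero.mpr (by exact_mod_cast h)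
  have hab' : (a : ℂ) - b ≠ 0 := by exact_mod_cast hab
  have key : ((u : ℂ)) ^ a * conj (u : ℂ) ^ b = -1 := by
    rw [← Circle.coe_inv_eq_conj, hu, ← Circle.exp_neg, Circle.coe_exp, Circle.coe_exp,
      ← Complex.exp_nat_mul, ← Complex.exp_nat_mul, ← Complex.exp_add, ← Complex.exp_pi_mul_I]
    congr 1
    push_cast
    field_simp
    ring
  have h1 : ∫ z, momentIntegrand N a b (rotation u z) = ∫ z, momentIntegrand N a b z :=
    (rotation u).measurePreserving.integral_comp
      (rotation u).toHomeomorph.measurableEmbedding _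
  have h2 : ∀ z, momentIntegrand N a b (rotation u z) = -momentIntegrand N a b z := by
    intro z
    have : momentIntegrand N a b (rotation u z) =
        ((u : ℂ) ^ a * conj (u : ℂ) ^ b) * momentIntegrand N a b z := by
      simp only [momentIntegrand, gaussianDensity, rotation_apply, map_mul, mul_pow, norm_mul,
        Circle.norm_coe, one_mul]
      ring
    rw [this, key]; ring
  simp_rw [h2, integral_neg] at h1
  have := neg_eq_self.mp h1
  exact this

theorem integral_momentIntegrand {N : ℕ} (hN : 0 < N) (a b : ℕ) :
    ∫ z, momentIntegrand N a b z = if a = b then (a.factorial : ℂ) / (N : ℂ) ^ a else 0 := by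
  split_ifs with h
  · subst h; exact integral_momentIntegrand_self hN a
  · exact integral_momentIntegrand_of_ne N h

/-- Integration by parts for the mixed moments of the complex Gaussian measure. -/
theorem natCast_mul_integral_momentIntegrand_pred {N : ℕ} (hN : 0 < N) (a b : ℕ) :
    (a : ℂ) * ∫ z, momentIntegrand N (a - 1) b z = N * ∫ z, momentIntegrand N a (b + 1) z := by
  have hN' : (N : ℂ) ≠ 0 := by exact_mod_cast hN.ne'
  rw [integral_momentIntegrand hN, integral_momentIntegrand hN]
  -- At `a = 0` the truncated exponent `a - 1` is harmless: the left factor is `0`, and the right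
  -- moment vanishes because `0 ≠ b + 1`.
  rcases a with - | a
  · simp
  · by_cases h : a = b
    · subst h
      simp only [Nat.add_sub_cancel, if_true, Nat.factorial_succ]
      push_cast; field_simp; ring
    · simp [h]

/-! ### Gaussian expectation of polynomials in the entries and their conjugates -/

/-- The index set of the matrix entries (left) and of their complex conjugates (right). -/
abbrev Var (N : ℕ) : Type := (Fin N × Fin N) ⊕ (Fin N × Fin N)

/-- The values of the variables at the matrix `M`. -/
def point {N : ℕ} (M : Entries N) : Var N → ℂ :=
  Sum.elim (fun e => M e.1 e.2) fun e => conj (M e.1 e.2)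

theorem trace_gram_re {N : ℕ} (M : Entries N) :
    (gram M).trace.re = ∑ i, ∑ j, ‖M i j‖ ^ 2 := by
  rw [Finset.sum_comm]
  simp only [gram, Matrix.trace, Matrix.diag, Matrix.mul_apply, Matrix.conjTranspose_apply,
    Matrix.of_apply, Complex.re_sum]
  refine Finset.sum_congr rfl fun i _ => Finset.sum_congr rfl fun j _ => ?_
  have : star (M j i) * M j i = ((‖M j i‖ ^ 2 : ℝ) : ℂ) := by
    rw [← Complex.normSq_eq_norm_sq]
    exact Complex.normSq_eq_conj_mul_self.symm
  rw [this, Complex.ofReal_re]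

theorem prod_gaussianDensity {N : ℕ} (M : Entries N) :
    ((N : ℝ) / Real.pi) ^ (N ^ 2) * Real.exp (-(N : ℝ) * (gram M).trace.re) =
      ∏ i, ∏ j, gaussianDensity N (M i j) := by
  simp only [gaussianDensity, Finset.prod_mul_distrib, Finset.prod_const, Finset.card_univ,
    Fintype.card_fin, ← Real.exp_sum, ← pow_mul, ← sq, trace_gram_re, Finset.mul_sum]

theorem continuous_gaussian_density (N : ℕ) : Continuous fun M : Entries N =>
    ∏ i, ∏ j, gaussianDensity N (M i j) := by
  unfold gaussianDensity
  fun_prop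

theorem gaussian_eq (N : ℕ) : gaussian N = (volume : Measure (Entries N)).withDensity fun M =>
    ENNReal.ofReal (∏ i, ∏ j, gaussianDensity N (M i j)) := by
  simp only [gaussian, prod_gaussianDensity]

theorem density_nonneg {N : ℕ} (M : Entries N) : 0 ≤ ∏ i, ∏ j, gaussianDensity N (M i j) :=
  Finset.prod_nonneg fun _ _ => Finset.prod_nonneg fun _ _ => gaussianDensity_nonneg _ _

theorem integrable_gaussian_iff {N : ℕ} {f : Entries N → ℂ} : Integrable f (gaussian N) ↔
    Integrable fun M : Entries N => ((∏ i, ∏ j, gaussianDensity N (M i j) : ℝ) : ℂ) * f M := by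
  rw [gaussian_eq, integrable_withDensity_iff_integrable_smul'
    (continuous_gaussian_density N).measurable.ennreal_ofReal (by simp)]
  simp only [ENNReal.toReal_ofReal (density_nonneg _), Complex.real_smul]

theorem integral_gaussian {N : ℕ} (f : Entries N → ℂ) : ∫ M, f M ∂(gaussian N) =
    ∫ M : Entries N, ((∏ i, ∏ j, gaussianDensity N (M i j) : ℝ) : ℂ) * f M := by
  rw [gaussian_eq, integral_withDensity_eq_integral_toReal_smul
    (continuous_gaussian_density N).measurable.ennreal_ofReal (by simp)]
  simp only [ENNReal.toReal_ofReal (density_nonneg _), Complex.real_smul]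

/-- Both the density and a monomial factor over the matrix entries, so Fubini reduces everything to
one-variable moments. -/
theorem density_mul_eval_monomial {N : ℕ} (m : Var N →₀ ℕ) (c : ℂ) (M : Entries N) :
    ((∏ i, ∏ j, gaussianDensity N (M i j) : ℝ) : ℂ) *
        MvPolynomial.eval (point M) (MvPolynomial.monomial m c) =
      c * ∏ i, ∏ j, momentIntegrand N (m (.inl (i, j))) (m (.inr (i, j))) (M i j) := by
  rw [MvPolynomial.eval_monomial, Finsupp.prod_fintype _ _ (by simp), Fintype.prod_sum_type,
    Fintype.prod_prod_type, Fintype.prod_prod_type]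
  simp only [momentIntegrand, Finset.prod_mul_distrib, point, Sum.elim_inl, Sum.elim_inr]
  push_cast
  ring

theorem integrable_eval {N : ℕ} (hN : 0 < N) (F : MvPolynomial (Var N) ℂ) :
    Integrable (fun M => MvPolynomial.eval (point M) F) (gaussian N) := by
  induction F using MvPolynomial.induction_on' with
  | monomial m c =>
    rw [integrable_gaussian_iff]
    simp_rw [density_mul_eval_monomial]
    refine Integrable.const_mul ?_ c
    exact Integrable.fintype_prod (f := fun i (x : Fin N → ℂ) =>
      ∏ j, momentIntegrand N (m (.inl (i, j))) (m (.inr (i, j))) (x j))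
      fun i => Integrable.fintype_prod fun j => integrable_momentIntegrand hN _ _
  | add p q hp hq =>
    simp only [map_add]
    exact hp.add hq

/-- The Gaussian expectation of a polynomial in the matrix entries and their conjugates. -/
noncomputable def expect (N : ℕ) (F : MvPolynomial (Var N) ℂ) : ℂ :=
  ∫ M, MvPolynomial.eval (point M) F ∂(gaussian N)

theorem expect_add {N : ℕ} (hN : 0 < N) (F G : MvPolynomial (Var N) ℂ) :
    expect N (F + G) = expect N F + expect N G := by
  simp only [expect, map_add]
  exact integral_add (integrable_eval hN F) (integrable_eval hN G)

theorem expect_C_mul {N : ℕ} (c : ℂ) (F : MvPolynomial (Var N) ℂ) :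
    expect N (MvPolynomial.C c * F) = c * expect N F := by
  simp only [expect, map_mul, MvPolynomial.eval_C]
  exact integral_const_mul _ _

theorem expect_sum {N : ℕ} (hN : 0 < N) {ι : Type*} (s : Finset ι)
    (F : ι → MvPolynomial (Var N) ℂ) : expect N (∑ i ∈ s, F i) = ∑ i ∈ s, expect N (F i) := by
  simp only [expect, map_sum]
  exact integral_finsetSum _ fun i _ => integrable_eval hN (F i)

theorem expect_monomial {N : ℕ} (m : Var N →₀ ℕ) (c : ℂ) :
    expect N (MvPolynomial.monomial m c) =
      c * ∏ e : Fin N × Fin N, ∫ z, momentIntegrand N (m (.inl e)) (m (.inr e)) z := by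
  rw [expect, integral_gaussian]
  simp_rw [density_mul_eval_monomial]
  rw [integral_const_mul, Fintype.prod_prod_type]
  congr 1
  rw [integral_fintype_prod_volume_eq_prod (fun i (x : Fin N → ℂ) =>
      ∏ j, momentIntegrand N (m (.inl (i, j))) (m (.inr (i, j))) (x j))]
  refine Finset.prod_congr rfl fun i _ => ?_
  exact integral_fintype_prod_volume_eq_prod
    (fun j => momentIntegrand N (m (.inl (i, j))) (m (.inr (i, j))))

theorem expect_one {N : ℕ} (hN : 0 < N) : expect N 1 = 1 := by
  have := expect_monomial (N := N) 0 1
  rw [← MvPolynomial.C_apply, map_one] at this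
  rw [this]
  simp [integral_momentIntegrand hN]

/-- Gaussian integration by parts for polynomials in the matrix entries. -/
theorem expect_pderiv {N : ℕ} (hN : 0 < N) (e : Fin N × Fin N) (F : MvPolynomial (Var N) ℂ) :
    expect N (MvPolynomial.pderiv (.inl e) F) = N * expect N (MvPolynomial.X (.inr e) * F) := by
  induction F using MvPolynomial.induction_on' with
  | add p q hp hq => rw [map_add, mul_add, expect_add hN, expect_add hN, hp, hq, mul_add]
  | monomial m c =>
    rw [MvPolynomial.pderiv_monomial, MvPolynomial.X, MvPolynomial.monomial_mul, one_mul,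
      expect_monomial, expect_monomial, ← Finset.mul_prod_erase _ _ (Finset.mem_univ e),
      ← Finset.mul_prod_erase _ _ (Finset.mem_univ e)]
    -- The two exponents differ only at the entry `e`, so every other factor cancels and the
    -- one-variable identity remains.
    set m₁ : Var N →₀ ℕ := m - Finsupp.single (Sum.inl e) 1 with hm₁
    set m₂ : Var N →₀ ℕ := Finsupp.single (Sum.inr e) 1 + m with hm₂
    have h1 : ∀ x ∈ Finset.univ.erase e,
        ∫ z, momentIntegrand N (m₁ (.inl x))
          (m₁ (.inr x)) z =
        ∫ z, momentIntegrand N (m₂ (.inl x))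
          (m₂ (.inr x)) z := by
      intro x hx
      have hx' : e ≠ x := (Finset.ne_of_mem_erase hx).symm
      simp [hm₁, hm₂, hx']
    rw [Finset.prod_congr rfl h1]
    have h2 := natCast_mul_integral_momentIntegrand_pred hN (m (.inl e)) (m (.inr e))
    have h3 : m₁ (Sum.inr e) = m (.inr e) := by simp [hm₁]
    have h4 : m₁ (Sum.inl e) = m (.inl e) - 1 := by simp [hm₁]
    have h5 : m₂ (Sum.inl e) = m (.inl e) := by simp [hm₂]
    have h6 : m₂ (Sum.inr e) = m (.inr e) + 1 := by simp [hm₂, add_comm]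
    rw [h3, h4, h5, h6]
    linear_combination c * (∏ x ∈ Finset.univ.erase e,
      ∫ z, momentIntegrand N (m₂ (.inl x))
          (m₂ (.inr x)) z) * h2

end MatrixModel

/-! ### Generic matrices and the Schwinger–Dyson equations -/

namespace MatrixModel

open MvPolynomial

/-- The generic matrix `M`. -/
noncomputable def genericMatrix (N : ℕ) : Matrix (Fin N) (Fin N) (MvPolynomial (Var N) ℂ) :=
  Matrix.of fun i j => X (.inl (i, j))

/-- The generic matrix `M†`. -/
noncomputable def genericAdjoint (N : ℕ) : Matrix (Fin N) (Fin N) (MvPolynomial (Var N) ℂ) :=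
  Matrix.of fun i j => X (.inr (j, i))

/-- The generic matrix `M† M`. -/
noncomputable def genericGram (N : ℕ) : Matrix (Fin N) (Fin N) (MvPolynomial (Var N) ℂ) :=
  genericAdjoint N * genericMatrix N

/-- The generic trace `Tr (M† M) ^ p`. -/
noncomputable def genericTrace (N p : ℕ) : MvPolynomial (Var N) ℂ :=
  (genericGram N ^ p).trace

theorem mapMatrix_eval_genericGram {N : ℕ} (M : Entries N) :
    (eval (point M)).mapMatrix (genericGram N) = gram M := by
  rw [genericGram, map_mul, gram]
  congr 1 <;> ext i j <;> simp [genericAdjoint, genericMatrix, point, Matrix.of_apply]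

theorem eval_genericTrace {N : ℕ} (M : Entries N) (p : ℕ) :
    eval (point M) (genericTrace N p) = (gram M ^ p).trace := by
  rw [← mapMatrix_eval_genericGram, ← map_pow, genericTrace]
  simp [Matrix.trace]

theorem genericTrace_zero (N : ℕ) : genericTrace N 0 = N := by
  simp [genericTrace]

theorem map_derivation_mul {R A n : Type*} [CommRing R] [CommRing A] [Algebra R A] [Fintype n]
    (D : Derivation R A A) (P Q : Matrix n n A) :
    (P * Q).map D = P.map D * Q + P * Q.map D := by
  ext i j
  simp only [Matrix.map_apply, Matrix.mul_apply, Matrix.add_apply, map_sum, Derivation.leibniz,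
    smul_eq_mul, ← Finset.sum_add_distrib]
  exact Finset.sum_congr rfl fun _ _ => by ring

theorem derivation_sum_apply {R A ι : Type*} [CommRing R] [CommRing A] [Algebra R A]
    (s : Finset ι) (D : ι → Derivation R A A) (f : A) : (∑ i ∈ s, D i) f = ∑ i ∈ s, D i f :=
  map_sum (AddMonoidHom.mk' (fun E : Derivation R A A => E f) fun _ _ => rfl) D s

/-- The derivation `∑ (M (M† M) ^ q)_ij ∂ / ∂ M_ij`. -/
noncomputable def virasoro (N q : ℕ) :
    Derivation ℂ (MvPolynomial (Var N) ℂ) (MvPolynomial (Var N) ℂ) :=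
  mkDerivation ℂ (Sum.elim (fun e => (genericMatrix N * genericGram N ^ q) e.1 e.2) fun _ => 0)

/-- Links the definition by values on variables, suited to the Leibniz rule, with the form in
partial derivatives that integration by parts needs. -/
theorem virasoro_apply (N q : ℕ) (f : MvPolynomial (Var N) ℂ) :
    virasoro N q f =
      ∑ i, ∑ j, (genericMatrix N * genericGram N ^ q) i j * pderiv (.inl (i, j)) f := by
  have : virasoro N q = ∑ i, ∑ j, (genericMatrix N * genericGram N ^ q) i j •
      (pderiv (.inl (i, j)) : Derivation ℂ (MvPolynomial (Var N) ℂ) (MvPolynomial (Var N) ℂ)) := by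
    refine derivation_ext fun e => ?_
    simp only [virasoro, mkDerivation_X, derivation_sum_apply, Derivation.smul_apply,
      smul_eq_mul, pderiv_X]
    rcases e with ⟨a, b⟩ | ⟨a, b⟩
    · rw [Finset.sum_eq_single a, Finset.sum_eq_single b]
      · simp
      · intro j _ hj
        simp [hj.symm]
      · simp
      · intro i _ hi
        refine Finset.sum_eq_zero fun j _ => ?_
        simp [hi.symm]
      · simp
    · simp
  rw [this]
  simp [derivation_sum_apply]

/-- `M` and `M†` are independent variables here: the derivation sends `M` to `M (M†M)^q` and kills
`M†`. -/
theorem map_virasoro_genericGram (N q : ℕ) :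
    (genericGram N).map (virasoro N q) = genericGram N ^ (q + 1) := by
  have h1 : (genericMatrix N).map (virasoro N q) = genericMatrix N * genericGram N ^ q := by
    ext i j
    simp [genericMatrix, virasoro, mkDerivation_X]
  have h2 : (genericAdjoint N).map (virasoro N q) = 0 := by
    ext i j
    simp [genericAdjoint, virasoro, mkDerivation_X]
  rw [genericGram, map_derivation_mul, h1, h2, zero_mul, zero_add, ← mul_assoc, ← genericGram,
    pow_succ']

theorem map_virasoro_genericGram_pow (N q p : ℕ) :
    (genericGram N ^ p).map (virasoro N q) = p • genericGram N ^ (q + p) := by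
  induction p with
  | zero =>
    ext i j
    by_cases h : i = j <;> simp [h]
  | succ p ih =>
    rw [pow_succ, map_derivation_mul, ih, map_virasoro_genericGram, smul_mul_assoc, ← pow_succ,
      ← pow_add, succ_nsmul, add_assoc, show p + (q + 1) = q + (p + 1) by ring]

theorem virasoro_genericTrace (N q p : ℕ) :
    virasoro N q (genericTrace N p) = p * genericTrace N (q + p) := by
  have : virasoro N q (genericTrace N p) = ((genericGram N ^ p).map (virasoro N q)).trace := by
    simp [genericTrace, Matrix.trace]
  rw [this, map_virasoro_genericGram_pow, Matrix.trace_smul, nsmul_eq_mul, genericTrace]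

/-- Induction on `q` by appending a factor `M†M`. Differentiating the old factors gives the terms `k
≤ q`; differentiating the new one closes the trace `Tr (M†M)^(q+1)`, the term `k = q + 1`. The
column `a` stays free because the induction contracts it with the appended factor. -/
theorem sum_pderiv_genericMatrix_mul_pow (N q : ℕ) (j a : Fin N) :
    ∑ i, pderiv (.inl (i, j)) ((genericMatrix N * genericGram N ^ q) i a) =
      ∑ k ∈ Finset.range (q + 1), genericTrace N k * (genericGram N ^ (q - k)) j a := by
  induction q generalizing a with
  | zero =>
    by_cases h : j = a
    · simp [genericMatrix, pderiv_X, genericTrace_zero, h]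
    · simp [genericMatrix, pderiv_X, h, Ne.symm h]
  | succ q ih =>
    have hW : ∀ i c, pderiv (.inl (i, j)) (genericGram N c a) =
        if j = a then genericAdjoint N c i else 0 := by
      intro i c
      simp only [genericGram, Matrix.mul_apply, map_sum, pderiv_mul, genericMatrix, genericAdjoint,
        Matrix.of_apply, pderiv_X, Pi.single_apply, Sum.inl.injEq, Prod.mk.injEq, reduceCtorEq,
        if_false, zero_mul, zero_add]
      by_cases h : j = a
      · simp [h]
      · simp [Ne.symm h, h]
    have hstep : ∀ i, pderiv (.inl (i, j)) ((genericMatrix N * genericGram N ^ (q + 1)) i a) =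
        ∑ c, pderiv (.inl (i, j)) ((genericMatrix N * genericGram N ^ q) i c) * genericGram N c a +
        if j = a then (genericMatrix N * genericGram N ^ q * genericAdjoint N) i i else 0 := by
      intro i
      rw [pow_succ, ← mul_assoc, Matrix.mul_apply, map_sum]
      simp only [pderiv_mul, hW, Finset.sum_add_distrib]
      congr 1
      split_ifs with h
      · rw [← Matrix.mul_apply]
      · simp
    simp only [hstep, Finset.sum_add_distrib]
    rw [Finset.sum_comm]
    simp only [← Finset.sum_mul, ih]
    rw [Finset.sum_range_succ]
    congr 1
    · simp only [Finset.sum_mul]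
      rw [Finset.sum_comm]
      refine Finset.sum_congr rfl fun k hk => ?_
      have hk' : q + 1 - k = (q - k) + 1 := by
        have := Finset.mem_range.mp hk
        omega
      rw [hk', pow_succ, Matrix.mul_apply, Finset.mul_sum]
      exact Finset.sum_congr rfl fun c _ => by ring
    · have ht : (genericMatrix N * genericGram N ^ q * genericAdjoint N).trace =
          genericTrace N (q + 1) := by
        rw [Matrix.trace_mul_comm, ← mul_assoc, ← genericGram, ← pow_succ', genericTrace]
      rw [Nat.sub_self, pow_zero, Matrix.one_apply]
      split_ifs with h
      · rw [mul_one, ← ht]; rfl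
      · simp

theorem divergence_genericMatrix_mul_pow (N q : ℕ) :
    ∑ i, ∑ j, pderiv (.inl (i, j)) ((genericMatrix N * genericGram N ^ q) i j) =
      ∑ k ∈ Finset.range (q + 1), genericTrace N k * genericTrace N (q - k) := by
  rw [Finset.sum_comm]
  simp only [sum_pderiv_genericMatrix_mul_pow]
  rw [Finset.sum_comm]
  refine Finset.sum_congr rfl fun k _ => ?_
  rw [← Finset.mul_sum]; rfl

/-- The Schwinger–Dyson equations of the Gaussian model. -/
theorem schwingerDyson {N : ℕ} (hN : 0 < N) (q : ℕ) (f : MvPolynomial (Var N) ℂ) :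
    N * expect N (genericTrace N (q + 1) * f) =
      ∑ k ∈ Finset.range (q + 1), expect N (genericTrace N k * genericTrace N (q - k) * f) +
        expect N (virasoro N q f) := by
  have h1 : genericTrace N (q + 1) * f = ∑ i, ∑ j, X (.inr (i, j)) *
      ((genericMatrix N * genericGram N ^ q) i j * f) := by
    rw [genericTrace, pow_succ', genericGram, mul_assoc, ← genericGram, Matrix.trace,
      Finset.sum_mul, Finset.sum_comm]
    refine Finset.sum_congr rfl fun i _ => ?_
    rw [Matrix.diag_apply, Matrix.mul_apply, Finset.sum_mul]
    exact Finset.sum_congr rfl fun j _ => by rw [mul_assoc]; rfl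
  have h2 : ∑ i, ∑ j, pderiv (.inl (i, j)) ((genericMatrix N * genericGram N ^ q) i j * f) =
      ∑ k ∈ Finset.range (q + 1), genericTrace N k * genericTrace N (q - k) * f +
        virasoro N q f := by
    rw [← Finset.sum_mul, ← divergence_genericMatrix_mul_pow, virasoro_apply]
    simp only [pderiv_mul, Finset.sum_add_distrib, Finset.sum_mul]
  rw [← expect_sum hN, ← expect_add hN, ← h2, h1]
  simp only [expect_sum hN, Finset.mul_sum, expect_pderiv hN]

end MatrixModel

/-! ### Generating functions in independent couplings and the finite-`N` loop equations -/

namespace MatrixModel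

/-- The weight `∏ (N / i) ^ m_i / m_i!` of a product of traces in the expansion of the exponential;
the index `i` of the multiplicities `m` stands for the exponent `i + 1`. -/
noncomputable def expCoeff (N : ℕ) (m : ℕ →₀ ℕ) : ℂ :=
  m.prod fun i k => ((N : ℂ) / (i + 1)) ^ k / k.factorial

theorem expCoeff_zero (N : ℕ) : expCoeff N 0 = 1 := by simp [expCoeff]

theorem expCoeff_add_single (N : ℕ) (m : ℕ →₀ ℕ) (i : ℕ) :
    expCoeff N (m + Finsupp.single i 1) * (m i + 1) = (N : ℂ) / (i + 1) * expCoeff N m := by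
  have hz : ∀ j : ℕ, ((N : ℂ) / (j + 1)) ^ 0 / (Nat.factorial 0 : ℂ) = 1 := by simp
  rw [expCoeff, expCoeff, ← Finsupp.mul_prod_erase' _ i _ (fun j => hz j),
    ← Finsupp.mul_prod_erase' m i _ (fun j => hz j)]
  have h1 : (m + Finsupp.single i 1).erase i = m.erase i := by
    simp [Finsupp.erase_add]
  have h2 : (m + Finsupp.single i 1 : ℕ →₀ ℕ) i = m i + 1 := by simp
  rw [h1, h2, pow_succ, Nat.factorial_succ]
  have h3 : ((m i : ℂ) + 1) ≠ 0 := by exact_mod_cast Nat.succ_ne_zero (m i)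
  have h4 : ((m i).factorial : ℂ) ≠ 0 := by exact_mod_cast Nat.factorial_ne_zero _
  push_cast
  field_simp

theorem natCast_mul_expCoeff_sub_single (N : ℕ) (m : ℕ →₀ ℕ) {i : ℕ} (hi : i ∈ m.support) :
    (N : ℂ) * expCoeff N (m - Finsupp.single i 1) = expCoeff N m * m i * (i + 1) := by
  have hle : Finsupp.single i 1 ≤ m := by
    rw [Finsupp.single_le_iff]
    exact Nat.one_le_iff_ne_zero.mpr (Finsupp.mem_support_iff.mp hi)
  have h := expCoeff_add_single N (m - Finsupp.single i 1) i
  have hi' : 1 ≤ m i := Nat.one_le_iff_ne_zero.mpr (Finsupp.mem_support_iff.mp hi)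
  rw [tsub_add_cancel_of_le hle, Finsupp.tsub_apply, Finsupp.single_eq_same, Nat.cast_sub hi'] at h
  have h3 : ((i : ℂ) + 1) ≠ 0 := by exact_mod_cast Nat.succ_ne_zero i
  field_simp at h
  linear_combination -h

/-- The formal power series `∑ t_i E_i`. -/
noncomputable def shiftSum (E : ℕ → MvPowerSeries ℕ ℂ) : MvPowerSeries ℕ ℂ :=
  fun m => ∑ i ∈ m.support, MvPowerSeries.coeff (m - Finsupp.single i 1) (E i)

theorem coeff_shiftSum (E : ℕ → MvPowerSeries ℕ ℂ) (m : ℕ →₀ ℕ) :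
    MvPowerSeries.coeff m (shiftSum E) =
      ∑ i ∈ m.support, MvPowerSeries.coeff (m - Finsupp.single i 1) (E i) := rfl

/-- Only variables in the support of `m` reach the coefficient at `m`. Allowing any larger finite
set lets one finite sum serve several monomials at once. -/
theorem coeff_shiftSum_of_subset (E : ℕ → MvPowerSeries ℕ ℂ) {m : ℕ →₀ ℕ} {s : Finset ℕ}
    (hs : m.support ⊆ s) :
    MvPowerSeries.coeff m (shiftSum E) =
      MvPowerSeries.coeff m (∑ i ∈ s, MvPowerSeries.X i * E i) := by
  rw [coeff_shiftSum, map_sum]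
  have h : ∀ i, MvPowerSeries.coeff m (MvPowerSeries.X i * E i) =
      if i ∈ m.support then MvPowerSeries.coeff (m - Finsupp.single i 1) (E i) else 0 := by
    intro i
    rw [MvPowerSeries.X, MvPowerSeries.coeff_monomial_mul]
    simp only [Finsupp.single_le_iff, Nat.one_le_iff_ne_zero, Finsupp.mem_support_iff, one_mul]
  simp only [h]
  rw [Finset.sum_ite_mem, Finset.inter_eq_right.mpr hs]

theorem shiftSum_mul (E : ℕ → MvPowerSeries ℕ ℂ) (H : MvPowerSeries ℕ ℂ) :
    shiftSum E * H = shiftSum fun i => E i * H := by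
  ext m
  rw [coeff_shiftSum_of_subset _ (Finset.Subset.refl _), MvPowerSeries.coeff_mul]
  have h : ∑ i ∈ m.support, MvPowerSeries.X i * (E i * H) =
      (∑ i ∈ m.support, MvPowerSeries.X i * E i) * H := by
    rw [Finset.sum_mul]
    exact Finset.sum_congr rfl fun _ _ => by ring
  rw [h, MvPowerSeries.coeff_mul]
  refine Finset.sum_congr rfl fun p hp => ?_
  rw [coeff_shiftSum_of_subset]
  refine Finsupp.support_mono ?_
  have hp' : p.1 + p.2 = m := by simpa using hp
  rw [← hp']
  exact le_self_add

theorem C_mul_shiftSum (c : ℂ) (E : ℕ → MvPowerSeries ℕ ℂ) :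
    MvPowerSeries.C c * shiftSum E = shiftSum fun i => MvPowerSeries.C c * E i := by
  rw [mul_comm, shiftSum_mul]
  simp only [mul_comm]

/-- The monomial `∏ t_i ^ m_i` in a family `t`. -/
noncomputable def familyMonomial {A : Type*} [CommSemiring A] (t : ℕ → A) (m : ℕ →₀ ℕ) : A :=
  m.prod fun i k => t i ^ k

theorem familyMonomial_zero {A : Type*} [CommSemiring A] (t : ℕ → A) :
    familyMonomial t 0 = 1 := by
  simp [familyMonomial]

theorem familyMonomial_add {A : Type*} [CommSemiring A] (t : ℕ → A) (m n : ℕ →₀ ℕ) :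
    familyMonomial t (m + n) = familyMonomial t m * familyMonomial t n :=
  Finsupp.prod_add_index' (by simp) fun _ _ _ => pow_add _ _ _

theorem familyMonomial_single {A : Type*} [CommSemiring A] (t : ℕ → A) (i : ℕ) :
    familyMonomial t (Finsupp.single i 1) = t i := by
  simp [familyMonomial]

theorem familyMonomial_sub_single {A : Type*} [CommSemiring A] (t : ℕ → A) {m : ℕ →₀ ℕ} {i : ℕ}
    (hi : i ∈ m.support) : t i * familyMonomial t (m - Finsupp.single i 1) = familyMonomial t m := by
  have hle : Finsupp.single i 1 ≤ m := by
    rw [Finsupp.single_le_iff]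
    exact Nat.one_le_iff_ne_zero.mpr (Finsupp.mem_support_iff.mp hi)
  conv_rhs => rw [← tsub_add_cancel_of_le hle, familyMonomial_add, familyMonomial_single]
  rw [mul_comm]

theorem map_familyMonomial {A B : Type*} [CommSemiring A] [CommSemiring B] (f : A →+* B)
    (t : ℕ → A) (m : ℕ →₀ ℕ) : f (familyMonomial t m) = familyMonomial (fun i => f (t i)) m := by
  simp [familyMonomial, Finsupp.prod, map_prod]

theorem derivation_familyMonomial {R A : Type*} [CommRing R] [CommRing A] [Algebra R A]
    (D : Derivation R A A) (t : ℕ → A) (m : ℕ →₀ ℕ) :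
    D (familyMonomial t m) =
      m.sum fun i k => k * D (t i) * familyMonomial t (m - Finsupp.single i 1) := by
  -- A common index set `s` lets the sums for `m`, `n` and `m + n` be compared term by term.
  suffices h : ∀ s : Finset ℕ, m.support ⊆ s → D (familyMonomial t m) =
      ∑ i ∈ s, m i * D (t i) * familyMonomial t (m - Finsupp.single i 1) from h _ subset_rfl
  induction m using Finsupp.induction_linear with
  | zero => simp [familyMonomial_zero]
  | add m n hm hn =>
    intro s hs
    have hs1 : m.support ⊆ s := (Finsupp.support_mono le_self_add).trans hs
    have hs2 : n.support ⊆ s := (Finsupp.support_mono le_add_self).trans hs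
    rw [familyMonomial_add, D.leibniz, hm s hs1, hn s hs2, smul_eq_mul, smul_eq_mul,
      Finset.mul_sum, Finset.mul_sum, ← Finset.sum_add_distrib]
    have key : ∀ (m n : ℕ →₀ ℕ) (i : ℕ), (m i : A) * (familyMonomial t n *
        familyMonomial t (m - Finsupp.single i 1)) =
          m i * familyMonomial t (m + n - Finsupp.single i 1) := by
      intro m n i
      rcases Nat.eq_zero_or_pos (m i) with h0 | h0
      · simp [h0]
      · have hle : Finsupp.single i 1 ≤ m := by rwa [Finsupp.single_le_iff]
        rw [tsub_add_eq_add_tsub hle |>.symm, familyMonomial_add, mul_comm (familyMonomial t n)]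
    refine Finset.sum_congr rfl fun i _ => ?_
    have h1 := key m n i
    have h2 := key n m i
    rw [add_comm n m] at h2
    rw [Finsupp.add_apply]
    push_cast
    linear_combination D (t i) * h1 + D (t i) * h2
  | single a k =>
    intro s hs
    rcases Nat.eq_zero_or_pos k with rfl | hk
    · simp [familyMonomial_zero]
    · have ha : a ∈ s := hs (by simp [hk.ne'])
      rw [Finset.sum_eq_single_of_mem a ha]
      · rw [← Finsupp.single_tsub]
        simp only [familyMonomial, Finsupp.prod_single_index, pow_zero, Finsupp.single_eq_same,
          Derivation.leibniz_pow, nsmul_eq_mul, smul_eq_mul]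
        ring
      · intro b _ hb
        simp [hb.symm]

/-- The product `∏ Tr (M† M) ^ (i + 1)` with multiplicities `m`. -/
noncomputable def traceMonomial (N : ℕ) (m : ℕ →₀ ℕ) : MvPolynomial (Var N) ℂ :=
  familyMonomial (fun i => genericTrace N (i + 1)) m

/-- The generating function of the correlations of `f` with arbitrary products of traces. -/
noncomputable def generatingFunction (N : ℕ) (f : MvPolynomial (Var N) ℂ) : MvPowerSeries ℕ ℂ :=
  fun m => expCoeff N m * expect N (f * traceMonomial N m)

theorem coeff_generatingFunction (N : ℕ) (f : MvPolynomial (Var N) ℂ) (m : ℕ →₀ ℕ) :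
    MvPowerSeries.coeff m (generatingFunction N f) =
      expCoeff N m * expect N (f * traceMonomial N m) := rfl

theorem constantCoeff_generatingFunction_one {N : ℕ} (hN : 0 < N) :
    MvPowerSeries.constantCoeff (generatingFunction N 1) = 1 := by
  rw [← MvPowerSeries.coeff_zero_eq_constantCoeff_apply, coeff_generatingFunction, expCoeff_zero,
    traceMonomial, familyMonomial_zero, mul_one, expect_one hN, mul_one]

/-- The factorials in `expCoeff` make this an exponential generating function, so a derivative
inserts one more trace. -/
theorem pderiv_generatingFunction (N i : ℕ) (f : MvPolynomial (Var N) ℂ) :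
    MvPowerSeries.pderiv ℂ i (generatingFunction N f) =
      MvPowerSeries.C ((N : ℂ) / (i + 1)) * generatingFunction N (genericTrace N (i + 1) * f) := by
  ext m
  rw [MvPowerSeries.coeff_pderiv, MvPowerSeries.coeff_C_mul, coeff_generatingFunction,
    coeff_generatingFunction, mul_right_comm, expCoeff_add_single, traceMonomial,
    familyMonomial_add, familyMonomial_single, ← traceMonomial,
    show f * (traceMonomial N m * genericTrace N (i + 1)) =
      genericTrace N (i + 1) * f * traceMonomial N m by ring]
  ring

theorem generatingFunction_mul_genericTrace_zero (N : ℕ) (f : MvPolynomial (Var N) ℂ) :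
    generatingFunction N (f * genericTrace N 0) = MvPowerSeries.C (N : ℂ) * generatingFunction N f := by
  ext m
  rw [MvPowerSeries.coeff_C_mul, coeff_generatingFunction, coeff_generatingFunction,
    genericTrace_zero, show f * (N : MvPolynomial (Var N) ℂ) * traceMonomial N m =
      MvPolynomial.C (N : ℂ) * (f * traceMonomial N m) by rw [map_natCast]; ring, expect_C_mul]
  ring

/-- The Schwinger–Dyson equations for the generating functions. -/
theorem generatingFunction_schwingerDyson {N : ℕ} (hN : 0 < N) (q : ℕ) :
    MvPowerSeries.C (N : ℂ) * generatingFunction N (genericTrace N (q + 1)) =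
      ∑ k ∈ Finset.range (q + 1), generatingFunction N (genericTrace N k * genericTrace N (q - k)) +
        MvPowerSeries.C (N : ℂ) *
          shiftSum fun i => generatingFunction N (genericTrace N (q + (i + 1))) := by
  ext m
  rw [MvPowerSeries.coeff_C_mul, map_add, map_sum, MvPowerSeries.coeff_C_mul, coeff_shiftSum]
  simp only [coeff_generatingFunction]
  rw [mul_left_comm, schwingerDyson hN, mul_add, Finset.mul_sum]
  congr 1
  rw [traceMonomial, derivation_familyMonomial, Finsupp.sum, expect_sum hN, Finset.mul_sum,
    Finset.mul_sum]
  refine Finset.sum_congr rfl fun i hi => ?_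
  -- The derivation contributes `m i * (i + 1)`, which is exactly what lowering `m` by one `t_i`
  -- costs in `expCoeff`, up to the factor `N`.
  rw [virasoro_genericTrace, ← mul_assoc (N : ℂ), natCast_mul_expCoeff_sub_single N m hi,
    ← traceMonomial, show ((m i : MvPolynomial (Var N) ℂ) *
      (((i + 1 : ℕ) : MvPolynomial (Var N) ℂ) * genericTrace N (q + (i + 1)))) *
        traceMonomial N (m - Finsupp.single i 1) = MvPolynomial.C ((m i : ℂ) * (i + 1)) *
          (genericTrace N (q + (i + 1)) * traceMonomial N (m - Finsupp.single i 1)) by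
      push_cast [map_mul, map_add, map_natCast, map_one]; ring, expect_C_mul]
  ring

/-- The normalized one-point functions `(1 / N) ⟨Tr (M† M) ^ p⟩ / ⟨1⟩` with generic couplings. -/
noncomputable def onePoint (N p : ℕ) : MvPowerSeries ℕ ℂ :=
  MvPowerSeries.C (1 / (N : ℂ)) *
    (generatingFunction N (genericTrace N p) * (generatingFunction N 1)⁻¹)

theorem generatingFunction_one_mul_inv {N : ℕ} (hN : 0 < N) :
    generatingFunction N 1 * (generatingFunction N 1)⁻¹ = 1 :=
  MvPowerSeries.mul_inv_cancel _ (by rw [constantCoeff_generatingFunction_one hN]; exact one_ne_zero)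

theorem C_natCast_mul_C_one_div {N : ℕ} (hN : 0 < N) :
    (MvPowerSeries.C (N : ℂ) * MvPowerSeries.C (1 / (N : ℂ)) : MvPowerSeries ℕ ℂ) = 1 := by
  rw [← map_mul, mul_one_div_cancel (by exact_mod_cast hN.ne'), map_one]

theorem onePoint_zero {N : ℕ} (hN : 0 < N) : onePoint N 0 = 1 := by
  have h := generatingFunction_mul_genericTrace_zero N 1
  rw [one_mul] at h
  rw [onePoint, h]
  linear_combination (MvPowerSeries.C (1 / (N : ℂ)) * MvPowerSeries.C (N : ℂ)) *
    generatingFunction_one_mul_inv hN + C_natCast_mul_C_one_div hN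

theorem generatingFunction_genericTrace {N : ℕ} (hN : 0 < N) (p : ℕ) :
    generatingFunction N (genericTrace N p) =
      MvPowerSeries.C (N : ℂ) * (onePoint N p * generatingFunction N 1) := by
  rw [onePoint]
  linear_combination (-generatingFunction N (genericTrace N p)) *
    (generatingFunction_one_mul_inv hN) - (generatingFunction N (genericTrace N p) *
      generatingFunction N 1 * (generatingFunction N 1)⁻¹) * C_natCast_mul_C_one_div hN

/-- The connected two-point function is a derivative of the one-point function. -/
theorem twoPoint_eq {N : ℕ} (hN : 0 < N) (k i : ℕ) :
    MvPowerSeries.C (1 / (N : ℂ)) ^ 2 *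
        (generatingFunction N (genericTrace N k * genericTrace N (i + 1)) *
          (generatingFunction N 1)⁻¹) =
      onePoint N k * onePoint N (i + 1) + MvPowerSeries.C (1 / (N : ℂ)) ^ 2 *
        (MvPowerSeries.C ((i : ℂ) + 1) * MvPowerSeries.pderiv ℂ i (onePoint N k)) := by
  have hab := C_natCast_mul_C_one_div hN
  have hZ := generatingFunction_one_mul_inv hN
  have hcd : (MvPowerSeries.C ((i : ℂ) + 1) * MvPowerSeries.C (1 / ((i : ℂ) + 1)) :
      MvPowerSeries ℕ ℂ) = 1 := by
    rw [← map_mul, mul_one_div_cancel (by exact_mod_cast Nat.succ_ne_zero i), map_one]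
  -- The quotient rule in product form: differentiate `N * onePoint * Z` rather than the quotient.
  have h := congrArg (MvPowerSeries.pderiv ℂ i) (generatingFunction_genericTrace hN k)
  rw [pderiv_generatingFunction, ← MvPowerSeries.smul_eq_C_mul _ (N : ℂ), Derivation.map_smul,
    Derivation.leibniz, pderiv_generatingFunction, MvPowerSeries.smul_eq_C_mul, smul_eq_mul,
    smul_eq_mul, mul_one, ← mul_one_div, map_mul, mul_comm (genericTrace N (i + 1))] at h
  rw [onePoint.eq_def N (i + 1)]
  generalize (MvPowerSeries.C (N : ℂ) : MvPowerSeries ℕ ℂ) = a at *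
  generalize (MvPowerSeries.C (1 / (N : ℂ)) : MvPowerSeries ℕ ℂ) = b at *
  generalize (MvPowerSeries.C ((i : ℂ) + 1) : MvPowerSeries ℕ ℂ) = c at *
  generalize (MvPowerSeries.C (1 / ((i : ℂ) + 1)) : MvPowerSeries ℕ ℂ) = d at *
  generalize (generatingFunction N 1)⁻¹ = I at *
  generalize generatingFunction N 1 = Z at *
  generalize MvPowerSeries.pderiv ℂ i (onePoint N k) = D at *
  generalize onePoint N k = P at *
  generalize generatingFunction N (genericTrace N k * genericTrace N (i + 1)) = G at *
  generalize generatingFunction N (genericTrace N (i + 1)) = U at *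
  have hG : G = c * D * Z + P * a * U := by
    linear_combination (b * c) * h + (c * D * Z + c * d * P * a * U - c * d * G) * hab
      + (P * a * U - G) * hcd
  rw [hG]
  linear_combination (b ^ 2 * c * D) * hZ + (b * P * U * I) * hab

/-- The loop equations at finite `N`. -/
theorem onePoint_succ {N : ℕ} (hN : 0 < N) (q : ℕ) :
    onePoint N (q + 1) = ∑ k ∈ Finset.range (q + 1), onePoint N k * onePoint N (q - k) +
      MvPowerSeries.C (1 / (N : ℂ)) ^ 2 * ∑ k ∈ Finset.range q,
        MvPowerSeries.C (((q - k - 1 : ℕ) : ℂ) + 1) *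
          MvPowerSeries.pderiv ℂ (q - k - 1) (onePoint N k) +
      shiftSum fun i => onePoint N (q + (i + 1)) := by
  have hab := C_natCast_mul_C_one_div hN
  have hZ := generatingFunction_one_mul_inv hN
  have hSD := generatingFunction_schwingerDyson hN q
  have hshift : (shiftSum fun i => onePoint N (q + (i + 1))) = MvPowerSeries.C (1 / (N : ℂ)) *
      ((shiftSum fun i => generatingFunction N (genericTrace N (q + (i + 1)))) *
        (generatingFunction N 1)⁻¹) := by
    rw [shiftSum_mul, C_mul_shiftSum]; rfl
  have hsum : ∑ k ∈ Finset.range (q + 1), onePoint N k * onePoint N (q - k) +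
      MvPowerSeries.C (1 / (N : ℂ)) ^ 2 * ∑ k ∈ Finset.range q,
        MvPowerSeries.C (((q - k - 1 : ℕ) : ℂ) + 1) *
          MvPowerSeries.pderiv ℂ (q - k - 1) (onePoint N k) =
      MvPowerSeries.C (1 / (N : ℂ)) ^ 2 * ((∑ k ∈ Finset.range (q + 1),
        generatingFunction N (genericTrace N k * genericTrace N (q - k))) *
          (generatingFunction N 1)⁻¹) := by
    -- The term `k = q` is split off: its second trace is `Tr 1 = N`, which corresponds to no
    -- coupling and factors without a `1/N²` correction.
    rw [Finset.sum_range_succ, Finset.sum_range_succ, add_mul, mul_add, Finset.sum_mul,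
      Finset.mul_sum, Finset.mul_sum, add_right_comm, ← Finset.sum_add_distrib]
    congr 1
    · refine Finset.sum_congr rfl fun k hk => ?_
      have hk' : q - k = (q - k - 1) + 1 := by
        have := Finset.mem_range.mp hk
        omega
      conv_lhs => rw [hk']
      conv_rhs => rw [hk']
      rw [twoPoint_eq hN]
      simp
    · rw [Nat.sub_self, onePoint_zero hN, mul_one, generatingFunction_mul_genericTrace_zero,
        onePoint]
      linear_combination (-MvPowerSeries.C (1 / (N : ℂ)) *
        generatingFunction N (genericTrace N q) * (generatingFunction N 1)⁻¹) * hab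
  rw [hsum, hshift, onePoint]
  generalize (MvPowerSeries.C (N : ℂ) : MvPowerSeries ℕ ℂ) = a at *
  generalize (MvPowerSeries.C (1 / (N : ℂ)) : MvPowerSeries ℕ ℂ) = b at *
  generalize (generatingFunction N 1)⁻¹ = I at *
  generalize generatingFunction N (genericTrace N (q + 1)) = G at *
  generalize (∑ k ∈ Finset.range (q + 1),
        generatingFunction N (genericTrace N k * genericTrace N (q - k))) = S at *
  generalize (shiftSum fun i => generatingFunction N (genericTrace N (q + (i + 1)))) = H at *
  linear_combination (b ^ 2 * I) * hSD + (b * H * I - b * G * I) * hab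

end MatrixModel

/-! ### The large-`N` limit with independent couplings -/

namespace MatrixModel

/-- The power of `α` carried by the monomial `t ^ m`, where `t_i` is `g_{i + 1} α ^ (i + 1)`. -/
noncomputable def alphaDegree (m : ℕ →₀ ℕ) : ℕ := m.sum fun i k => (i + 1) * k

theorem alphaDegree_add (m n : ℕ →₀ ℕ) : alphaDegree (m + n) = alphaDegree m + alphaDegree n :=
  Finsupp.sum_add_index' (by simp) fun _ _ _ => mul_add _ _ _

theorem alphaDegree_single (i k : ℕ) : alphaDegree (Finsupp.single i k) = (i + 1) * k := by
  simp [alphaDegree]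

theorem alphaDegree_sub_single {m : ℕ →₀ ℕ} {i : ℕ} (hi : i ∈ m.support) :
    alphaDegree (m - Finsupp.single i 1) + (i + 1) = alphaDegree m := by
  have hle : Finsupp.single i 1 ≤ m := by
    rw [Finsupp.single_le_iff]
    exact Nat.one_le_iff_ne_zero.mpr (Finsupp.mem_support_iff.mp hi)
  conv_rhs => rw [← tsub_add_cancel_of_le hle, alphaDegree_add, alphaDegree_single, mul_one]

theorem support_subset_range_alphaDegree (m : ℕ →₀ ℕ) :
    m.support ⊆ Finset.range (alphaDegree m) := by
  intro i hi
  have := alphaDegree_sub_single hi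
  rw [Finset.mem_range]
  omega

theorem alphaDegree_eq_zero {m : ℕ →₀ ℕ} (h : alphaDegree m = 0) : m = 0 := by
  have := support_subset_range_alphaDegree m
  rw [h, Finset.range_zero, Finset.subset_empty] at this
  exact Finsupp.support_eq_empty.mp this

theorem tendsto_C_one_div_sq_mul {F : ℕ → MvPowerSeries ℕ ℂ} {m : ℕ →₀ ℕ} {l : ℂ}
    (h : Tendsto (fun N => MvPowerSeries.coeff m (F N)) atTop (𝓝 l)) :
    Tendsto (fun N : ℕ => MvPowerSeries.coeff m (MvPowerSeries.C (1 / (N : ℂ)) ^ 2 * F N)) atTop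
      (𝓝 0) := by
  have h0 : Tendsto (fun N : ℕ => (1 / (N : ℂ)) ^ 2) atTop (𝓝 0) := by
    simpa using (tendsto_one_div_atTop_nhds_zero_nat (𝕜 := ℂ)).pow 2
  simpa only [← map_pow, MvPowerSeries.coeff_C_mul, zero_mul] using h0.mul h

/-- Every coefficient of the one-point functions converges as `N → ∞`. -/
theorem exists_tendsto_coeff_onePoint (p : ℕ) (m : ℕ →₀ ℕ) :
    ∃ l, Tendsto (fun N => MvPowerSeries.coeff m (onePoint N p)) atTop (𝓝 l) := by
  -- For `p = q + 1`, products involve weights at most `q + alphaDegree m`. In the derivative term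
  -- the index drops to `k` while the degree gains `q - k`; in the shift term the index gains `i +
  -- 1` while the degree loses it. Both have weight exactly `q + alphaDegree m`.
  induction hw : p + alphaDegree m using Nat.strong_induction_on generalizing p m with
  | _ w ih =>
  subst hw
  rcases p with - | q
  · refine ⟨MvPowerSeries.coeff m 1, tendsto_const_nhds.congr' ?_⟩
    filter_upwards [eventually_gt_atTop 0] with N hN
    rw [onePoint_zero hN]
  · replace ih : ∀ p n, p + alphaDegree n < q + 1 + alphaDegree m →
        ∃ l, Tendsto (fun N => MvPowerSeries.coeff n (onePoint N p)) atTop (𝓝 l) :=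
      fun p n h => ih _ h p n rfl
    have h1 : ∃ l, Tendsto (fun N => MvPowerSeries.coeff m
        (∑ k ∈ Finset.range (q + 1), onePoint N k * onePoint N (q - k))) atTop (𝓝 l) := by
      have : ∀ k ∈ Finset.range (q + 1), ∃ l, Tendsto (fun N => MvPowerSeries.coeff m
          (onePoint N k * onePoint N (q - k))) atTop (𝓝 l) := by
        intro k hk
        have hk' := Finset.mem_range.mp hk
        simp only [MvPowerSeries.coeff_mul]
        have hx : ∀ x ∈ Finset.HasAntidiagonal.antidiagonal m, ∃ l, Tendsto (fun N =>
            MvPowerSeries.coeff x.1 (onePoint N k) * MvPowerSeries.coeff x.2 (onePoint N (q - k)))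
              atTop (𝓝 l) := by
          intro x hx
          have hx' : x.1 + x.2 = m := by simpa using hx
          have hd := alphaDegree_add x.1 x.2
          rw [hx'] at hd
          obtain ⟨l, hl⟩ := ih k x.1 (by omega)
          obtain ⟨l', hl'⟩ := ih (q - k) x.2 (by omega)
          exact ⟨_, hl.mul hl'⟩
        choose! l hl using hx
        exact ⟨_, tendsto_finsetSum _ hl⟩
      choose! l hl using this
      simp only [map_sum]
      exact ⟨_, tendsto_finsetSum _ hl⟩
    have h2 : ∃ l, Tendsto (fun N => MvPowerSeries.coeff m (∑ k ∈ Finset.range q,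
        MvPowerSeries.C (((q - k - 1 : ℕ) : ℂ) + 1) *
          MvPowerSeries.pderiv ℂ (q - k - 1) (onePoint N k))) atTop (𝓝 l) := by
      have : ∀ k ∈ Finset.range q, ∃ l, Tendsto (fun N => MvPowerSeries.coeff m
          (MvPowerSeries.C (((q - k - 1 : ℕ) : ℂ) + 1) *
            MvPowerSeries.pderiv ℂ (q - k - 1) (onePoint N k))) atTop (𝓝 l) := by
        intro k hk
        have hk' := Finset.mem_range.mp hk
        simp only [MvPowerSeries.coeff_C_mul, MvPowerSeries.coeff_pderiv]
        obtain ⟨l, hl⟩ := ih k (m + Finsupp.single (q - k - 1) 1) (by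
          rw [alphaDegree_add, alphaDegree_single]; omega)
        exact ⟨_, (hl.mul_const _).const_mul _⟩
      choose! l hl using this
      simp only [map_sum]
      exact ⟨_, tendsto_finsetSum _ hl⟩
    have h3 : ∃ l, Tendsto (fun N => MvPowerSeries.coeff m
        (shiftSum fun i => onePoint N (q + (i + 1)))) atTop (𝓝 l) := by
      have : ∀ i ∈ m.support, ∃ l, Tendsto (fun N => MvPowerSeries.coeff (m - Finsupp.single i 1)
          (onePoint N (q + (i + 1)))) atTop (𝓝 l) := by
        intro i hi
        have := alphaDegree_sub_single hi
        exact ih _ _ (by omega)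
      choose! l hl using this
      simp only [coeff_shiftSum]
      exact ⟨_, tendsto_finsetSum _ hl⟩
    obtain ⟨l₁, h1⟩ := h1
    obtain ⟨l₂, h2⟩ := h2
    obtain ⟨l₃, h3⟩ := h3
    refine ⟨_, ((h1.add (tendsto_C_one_div_sq_mul h2)).add h3).congr' ?_⟩
    filter_upwards [eventually_gt_atTop 0] with N hN
    rw [onePoint_succ hN q, map_add, map_add]

/-- The planar limit of the one-point functions. -/
noncomputable def planarOnePoint (p : ℕ) : MvPowerSeries ℕ ℂ :=
  fun m => (exists_tendsto_coeff_onePoint p m).choose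

theorem tendsto_coeff_onePoint (p : ℕ) (m : ℕ →₀ ℕ) :
    Tendsto (fun N => MvPowerSeries.coeff m (onePoint N p)) atTop
      (𝓝 (MvPowerSeries.coeff m (planarOnePoint p))) :=
  (exists_tendsto_coeff_onePoint p m).choose_spec

theorem planarOnePoint_zero : planarOnePoint 0 = 1 := by
  ext m
  refine tendsto_nhds_unique (tendsto_coeff_onePoint 0 m) (tendsto_const_nhds.congr' ?_)
  filter_upwards [eventually_gt_atTop 0] with N hN
  rw [onePoint_zero hN]

/-- The planar loop equations. -/
theorem planarOnePoint_succ (q : ℕ) :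
    planarOnePoint (q + 1) =
      ∑ k ∈ Finset.range (q + 1), planarOnePoint k * planarOnePoint (q - k) +
        shiftSum fun i => planarOnePoint (q + (i + 1)) := by
  ext m
  have h1 : Tendsto (fun N => MvPowerSeries.coeff m
      (∑ k ∈ Finset.range (q + 1), onePoint N k * onePoint N (q - k))) atTop
      (𝓝 (MvPowerSeries.coeff m
        (∑ k ∈ Finset.range (q + 1), planarOnePoint k * planarOnePoint (q - k)))) := by
    simp only [map_sum, MvPowerSeries.coeff_mul]
    exact tendsto_finsetSum _ fun k _ => tendsto_finsetSum _ fun x _ =>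
      (tendsto_coeff_onePoint _ _).mul (tendsto_coeff_onePoint _ _)
  have h2 : Tendsto (fun N => MvPowerSeries.coeff m (∑ k ∈ Finset.range q,
      MvPowerSeries.C (((q - k - 1 : ℕ) : ℂ) + 1) *
        MvPowerSeries.pderiv ℂ (q - k - 1) (onePoint N k))) atTop
      (𝓝 (MvPowerSeries.coeff m (∑ k ∈ Finset.range q,
        MvPowerSeries.C (((q - k - 1 : ℕ) : ℂ) + 1) *
          MvPowerSeries.pderiv ℂ (q - k - 1) (planarOnePoint k)))) := by
    simp only [map_sum, MvPowerSeries.coeff_C_mul, MvPowerSeries.coeff_pderiv]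
    exact tendsto_finsetSum _ fun k _ => ((tendsto_coeff_onePoint _ _).mul_const _).const_mul _
  have h3 : Tendsto (fun N => MvPowerSeries.coeff m
      (shiftSum fun i => onePoint N (q + (i + 1)))) atTop
      (𝓝 (MvPowerSeries.coeff m (shiftSum fun i => planarOnePoint (q + (i + 1))))) := by
    simp only [coeff_shiftSum]
    exact tendsto_finsetSum _ fun i _ => tendsto_coeff_onePoint _ _
  refine tendsto_nhds_unique (tendsto_coeff_onePoint (q + 1) m) ?_
  have := (h1.add (tendsto_C_one_div_sq_mul h2)).add h3
  rw [add_zero, ← map_add] at this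
  refine this.congr' ?_
  filter_upwards [eventually_gt_atTop 0] with N hN
  rw [onePoint_succ hN q, map_add, map_add]

/-! ### Specialization of the couplings to powers of `α` -/

/-- The values `g_{i + 1} α ^ (i + 1)` of the generic couplings. -/
noncomputable def coupling (g : ℕ → ℂ) (i : ℕ) : PowerSeries ℂ :=
  PowerSeries.C (g (i + 1)) * PowerSeries.X ^ (i + 1)

theorem coeff_coupling (g : ℕ → ℂ) (i s : ℕ) :
    PowerSeries.coeff s (coupling g i) = if s = i + 1 then g (i + 1) else 0 := by
  rw [coupling, PowerSeries.coeff_C_mul, PowerSeries.coeff_X_pow]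
  simp

theorem hasSubst_coupling (g : ℕ → ℂ) : MvPowerSeries.HasSubst (coupling g) where
  const_coeff i := by
    have : MvPowerSeries.constantCoeff (coupling g i) = 0 := by
      have := coeff_coupling g i 0
      rwa [PowerSeries.coeff_zero_eq_constantCoeff_apply, if_neg (Nat.succ_ne_zero i).symm] at this
    rw [this]
    exact IsNilpotent.zero
  coeff_zero d := by
    refine (Set.finite_singleton (d () - 1)).subset fun i hi => ?_
    have hd : d = Finsupp.single () (d ()) := by ext; simp
    by_contra hne
    refine hi ?_
    rw [hd]
    refine (coeff_coupling g i (d ())).trans (if_neg fun h => hne ?_)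
    simp [h]

/-- The evaluation of the generic couplings at `g_{i + 1} α ^ (i + 1)`. -/
noncomputable def specialize (g : ℕ → ℂ) : MvPowerSeries ℕ ℂ →ₐ[ℂ] PowerSeries ℂ :=
  MvPowerSeries.substAlgHom (hasSubst_coupling g)

theorem specialize_X_mul (g : ℕ → ℂ) (i : ℕ) (F : MvPowerSeries ℕ ℂ) :
    specialize g (MvPowerSeries.X i * F) = coupling g i * specialize g F := by
  rw [map_mul]
  congr 1
  exact MvPowerSeries.substAlgHom_X (hasSubst_coupling g) i

theorem prod_coupling (g : ℕ → ℂ) (m : ℕ →₀ ℕ) :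
    (m.prod fun i k => coupling g i ^ k) =
      PowerSeries.C (familyMonomial (fun i => g (i + 1)) m) * PowerSeries.X ^ alphaDegree m := by
  simp only [coupling, mul_pow, familyMonomial, alphaDegree, Finsupp.prod, Finsupp.sum,
    Finset.prod_mul_distrib, map_prod, map_pow, ← pow_mul, Finset.prod_pow_eq_pow_sum]

theorem coeff_prod_coupling (g : ℕ → ℂ) (m : ℕ →₀ ℕ) (s : ℕ) :
    MvPowerSeries.coeff (Finsupp.single () s) (m.prod fun i k => coupling g i ^ k) =
      if alphaDegree m = s then familyMonomial (fun i => g (i + 1)) m else 0 := by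
  rw [prod_coupling]
  change PowerSeries.coeff s _ = _
  rw [PowerSeries.coeff_C_mul, PowerSeries.coeff_X_pow]
  simp [eq_comm]

/-- With all couplings and all coefficients equal to `1`, each such `m` contributes a nonzero term
to the coefficient of `α^s`, and substitution allows only finitely many of these. -/
theorem finite_alphaDegree_eq (s : ℕ) : {m : ℕ →₀ ℕ | alphaDegree m = s}.Finite := by
  have h := MvPowerSeries.coeff_subst_finite (hasSubst_coupling fun _ => 1)
    (fun _ => 1 : MvPowerSeries ℕ ℂ) (Finsupp.single () s)
  refine Set.Finite.subset h fun m hm => ?_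
  have hone : familyMonomial (fun _ : ℕ => (1 : ℂ)) m = 1 := by simp [familyMonomial]
  have h1 : MvPowerSeries.coeff m (fun _ => 1 : MvPowerSeries ℕ ℂ) = 1 := rfl
  rw [Function.mem_support, coeff_prod_coupling, if_pos (show alphaDegree m = s from hm), hone, h1]
  simp

theorem coeff_specialize (g : ℕ → ℂ) (F : MvPowerSeries ℕ ℂ) (s : ℕ) :
    PowerSeries.coeff s (specialize g F) = ∑ m ∈ (finite_alphaDegree_eq s).toFinset,
      MvPowerSeries.coeff m F * familyMonomial (fun i => g (i + 1)) m := by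
  rw [specialize, MvPowerSeries.coe_substAlgHom]
  refine (MvPowerSeries.coeff_subst (hasSubst_coupling g) F (Finsupp.single () s)).trans ?_
  simp only [coeff_prod_coupling, smul_eq_mul]
  rw [finsum_eq_sum_of_support_subset _ (s := (finite_alphaDegree_eq s).toFinset)]
  · refine Finset.sum_congr rfl fun m hm => ?_
    rw [if_pos (by simpa using hm)]
  · intro m hm
    by_contra h
    refine hm ?_
    simp only [Set.Finite.coe_toFinset, Set.mem_ofPred_eq] at h
    exact (congrArg _ (if_neg h)).trans (mul_zero _)

theorem coeff_zero_specialize (g : ℕ → ℂ) (F : MvPowerSeries ℕ ℂ) :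
    PowerSeries.coeff 0 (specialize g F) = MvPowerSeries.coeff 0 F := by
  rw [coeff_specialize, Finset.sum_eq_single 0]
  · rw [familyMonomial_zero, mul_one]
  · intro m hm h
    exact absurd (alphaDegree_eq_zero (by simpa using hm)) h
  · intro h
    exact absurd (by simp [alphaDegree]) h

theorem coeff_coupling_mul (g : ℕ → ℂ) (i s : ℕ) (F : PowerSeries ℂ) :
    PowerSeries.coeff s (coupling g i * F) =
      if i < s then g (i + 1) * PowerSeries.coeff (s - (i + 1)) F else 0 := by
  rw [coupling, mul_assoc, PowerSeries.coeff_C_mul, PowerSeries.coeff_X_pow_mul']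
  simp

theorem coeff_specialize_shiftSum (g : ℕ → ℂ) (E : ℕ → MvPowerSeries ℕ ℂ) (s : ℕ) :
    PowerSeries.coeff s (specialize g (shiftSum E)) =
      ∑ i ∈ Finset.range s, PowerSeries.coeff s (coupling g i * specialize g (E i)) := by
  have h : PowerSeries.coeff s (specialize g (shiftSum E)) =
      PowerSeries.coeff s (specialize g (∑ i ∈ Finset.range s, MvPowerSeries.X i * E i)) := by
    rw [coeff_specialize, coeff_specialize]
    refine Finset.sum_congr rfl fun m hm => ?_
    have hm' : alphaDegree m = s := by simpa using hm
    rw [coeff_shiftSum_of_subset E (hm' ▸ support_subset_range_alphaDegree m)]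
  rw [h, map_sum, map_sum]
  simp only [specialize_X_mul]

theorem hasSum_coupling_mul_specialize (g : ℕ → ℂ) (E : ℕ → MvPowerSeries ℕ ℂ) :
    HasSum (fun i => coupling g i * specialize g (E i)) (specialize g (shiftSum E)) := by
  rw [PowerSeries.WithPiTopology.hasSum_iff_hasSum_coeff]
  intro s
  rw [coeff_specialize_shiftSum]
  refine hasSum_sum_of_ne_finset_zero fun i hi => ?_
  rw [coeff_coupling_mul, if_neg (by simpa using hi)]

/-! ### Identification with the model's interaction factor and correlations -/

/-- The expansion of the interaction factor in the generic couplings. -/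
noncomputable def weightExpansion {N : ℕ} (M : Entries N) : MvPowerSeries ℕ ℂ :=
  fun m => expCoeff N m * familyMonomial (fun i => (gram M ^ (i + 1)).trace) m

theorem coeff_weightExpansion {N : ℕ} (M : Entries N) (m : ℕ →₀ ℕ) :
    MvPowerSeries.coeff m (weightExpansion M) =
      expCoeff N m * familyMonomial (fun i => (gram M ^ (i + 1)).trace) m := rfl

/-- Euler's identity for the grading in which `t_i` has degree `i + 1`; it becomes `α d/dα` after
specialization. -/
theorem alphaDegree_mul_coeff_weightExpansion {N : ℕ} (M : Entries N) (m : ℕ →₀ ℕ) :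
    (alphaDegree m : ℂ) * MvPowerSeries.coeff m (weightExpansion M) = MvPowerSeries.coeff m
      (shiftSum fun i => MvPowerSeries.C (N * (gram M ^ (i + 1)).trace) * weightExpansion M) := by
  rw [coeff_shiftSum, alphaDegree, Finsupp.sum, Nat.cast_sum, Finset.sum_mul]
  refine Finset.sum_congr rfl fun i hi => ?_
  rw [MvPowerSeries.coeff_C_mul, coeff_weightExpansion, coeff_weightExpansion,
    ← familyMonomial_sub_single _ hi]
  have := natCast_mul_expCoeff_sub_single N m hi
  push_cast
  linear_combination -((gram M ^ (i + 1)).trace * familyMonomial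
    (fun i => (gram M ^ (i + 1)).trace) (m - Finsupp.single i 1)) * this

theorem natCast_mul_coeff_specialize_weightExpansion (g : ℕ → ℂ) {N : ℕ} (M : Entries N) (s : ℕ) :
    (s : ℂ) * PowerSeries.coeff s (specialize g (weightExpansion M)) =
      ∑ i ∈ Finset.range s, N * g (i + 1) * (gram M ^ (i + 1)).trace *
        PowerSeries.coeff (s - (i + 1)) (specialize g (weightExpansion M)) := by
  have h : (s : ℂ) * PowerSeries.coeff s (specialize g (weightExpansion M)) =
      PowerSeries.coeff s (specialize g (shiftSum fun i =>
        MvPowerSeries.C (N * (gram M ^ (i + 1)).trace) * weightExpansion M)) := by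
    rw [coeff_specialize, coeff_specialize, Finset.mul_sum]
    refine Finset.sum_congr rfl fun m hm => ?_
    have hm' : alphaDegree m = s := by simpa using hm
    rw [← alphaDegree_mul_coeff_weightExpansion, hm', mul_assoc]
  rw [h, coeff_specialize_shiftSum]
  refine Finset.sum_congr rfl fun i hi => ?_
  rw [coeff_coupling_mul, if_pos (Finset.mem_range.mp hi), ← MvPowerSeries.smul_eq_C_mul, map_smul,
    map_smul, smul_eq_mul]
  ring

theorem derivative_weight (g : ℕ → ℂ) {N : ℕ} (M : Entries N) :
    PowerSeries.derivative ℂ (weight g M) = weight g M *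
      PowerSeries.mk fun n => (N : ℂ) * g (n + 1) * (gram M ^ (n + 1)).trace := by
  rw [weight, PowerSeries.derivative_subst (hasSubst_tracePotential g M),
    PowerSeries.derivative_exp]
  congr 1
  ext n
  have hn : ((n : ℂ) + 1) ≠ 0 := by exact_mod_cast Nat.succ_ne_zero n
  rw [PowerSeries.coeff_derivative, PowerSeries.coeff_mk]
  simp only [map_neg, map_smul, tracePotential, potential, PowerSeries.coeff_mk,
    Nat.succ_ne_zero, if_false, smul_eq_mul]
  push_cast
  field_simp

theorem natCast_mul_coeff_weight (g : ℕ → ℂ) {N : ℕ} (M : Entries N) (s : ℕ) :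
    (s : ℂ) * PowerSeries.coeff s (weight g M) =
      ∑ i ∈ Finset.range s, N * g (i + 1) * (gram M ^ (i + 1)).trace *
        PowerSeries.coeff (s - (i + 1)) (weight g M) := by
  rcases s with - | s
  · simp
  · have h := congrArg (PowerSeries.coeff s) (derivative_weight g M)
    rw [PowerSeries.coeff_derivative, mul_comm (weight g M), PowerSeries.coeff_mul,
      Finset.Nat.sum_antidiagonal_eq_sum_range_succ_mk] at h
    simp only [PowerSeries.coeff_mk] at h
    push_cast
    rw [mul_comm, h]

theorem coeff_zero_weight (g : ℕ → ℂ) {N : ℕ} (M : Entries N) :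
    PowerSeries.coeff 0 (weight g M) = 1 := by
  have h0 : PowerSeries.constantCoeff (-((N : ℂ) • tracePotential g M)) = 0 := by
    rw [← PowerSeries.coeff_zero_eq_constantCoeff_apply]
    simp [tracePotential, potential, -PowerSeries.coeff_zero_eq_constantCoeff]
  have h1 : PowerSeries.constantCoeff (PowerSeries.exp ℂ - 1) = 0 := by simp
  have h := PowerSeries.constantCoeff_subst_eq_zero h0 _ h1
  have hs := hasSubst_tracePotential g M
  rw [PowerSeries.subst_sub hs, ← PowerSeries.coe_substAlgHom hs, map_one,
    PowerSeries.coe_substAlgHom] at h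
  rw [PowerSeries.coeff_zero_eq_constantCoeff_apply, weight]
  exact sub_eq_zero.mp ((map_sub _ _ _).symm.trans h |>.trans rfl) |>.trans (map_one _)

/-- Both series have constant term `1` and satisfy the recursion coming from `α w' = (α S') w`,
where `S = -N Tr V(α M†M)`; this determines them without expanding the exponential of an infinite
sum. -/
theorem weight_eq_specialize (g : ℕ → ℂ) {N : ℕ} (M : Entries N) :
    weight g M = specialize g (weightExpansion M) := by
  ext s
  induction s using Nat.strong_induction_on with
  | _ s ih =>
  rcases Nat.eq_zero_or_pos s with rfl | hs
  · rw [coeff_zero_weight, coeff_zero_specialize, coeff_weightExpansion, expCoeff_zero,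
      familyMonomial_zero, mul_one]
  · have hs' : (s : ℂ) ≠ 0 := by exact_mod_cast hs.ne'
    refine mul_left_cancel₀ hs' ?_
    rw [natCast_mul_coeff_weight, natCast_mul_coeff_specialize_weightExpansion]
    refine Finset.sum_congr rfl fun i hi => ?_
    rw [ih _ (by omega)]

theorem eval_mul_coeff_weight (g : ℕ → ℂ) {N : ℕ} (f : MvPolynomial (Var N) ℂ) (M : Entries N)
    (s : ℕ) : MvPolynomial.eval (point M) f * PowerSeries.coeff s (weight g M) =
      MvPolynomial.eval (point M) (∑ m ∈ (finite_alphaDegree_eq s).toFinset,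
        MvPolynomial.C (expCoeff N m * familyMonomial (fun i => g (i + 1)) m) *
          (f * traceMonomial N m)) := by
  rw [weight_eq_specialize, coeff_specialize, Finset.mul_sum, map_sum]
  refine Finset.sum_congr rfl fun m _ => ?_
  rw [coeff_weightExpansion, map_mul (MvPolynomial.eval _), map_mul (MvPolynomial.eval _),
    MvPolynomial.eval_C, traceMonomial, map_familyMonomial]
  simp only [eval_genericTrace]
  ring

theorem integrable_eval_mul_coeff_weight (g : ℕ → ℂ) {N : ℕ} (hN : 0 < N)
    (f : MvPolynomial (Var N) ℂ) (s : ℕ) :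
    Integrable (fun M => MvPolynomial.eval (point M) f * PowerSeries.coeff s (weight g M))
      (gaussian N) := by
  simp only [eval_mul_coeff_weight]
  exact integrable_eval hN _

theorem correlation_eval (g : ℕ → ℂ) {N : ℕ} (hN : 0 < N) (f : MvPolynomial (Var N) ℂ) :
    correlation g N (fun M => MvPolynomial.eval (point M) f) =
      specialize g (generatingFunction N f) := by
  ext s
  rw [correlation, PowerSeries.coeff_mk]
  simp only [eval_mul_coeff_weight]
  rw [coeff_specialize, ← expect, expect_sum hN]
  refine Finset.sum_congr rfl fun m _ => ?_
  rw [expect_C_mul, coeff_generatingFunction]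
  ring

theorem partitionFunction_eq_specialize (g : ℕ → ℂ) {N : ℕ} (hN : 0 < N) :
    partitionFunction g N = specialize g (generatingFunction N 1) := by
  rw [← correlation_eval g hN]
  simp [partitionFunction]

theorem constantCoeff_partitionFunction (g : ℕ → ℂ) {N : ℕ} (hN : 0 < N) :
    PowerSeries.constantCoeff (partitionFunction g N) = 1 := by
  rw [← PowerSeries.coeff_zero_eq_constantCoeff_apply, partitionFunction_eq_specialize g hN,
    coeff_zero_specialize, MvPowerSeries.coeff_zero_eq_constantCoeff_apply,
    constantCoeff_generatingFunction_one hN]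

theorem resolventCoeff_eq_specialize (g : ℕ → ℂ) {N : ℕ} (hN : 0 < N) (p : ℕ) :
    resolventCoeff g N p = specialize g (onePoint N p) := by
  -- An algebra homomorphism preserves the relation `Z * Z⁻¹ = 1`, which characterizes the inverse.
  have hZ : specialize g (generatingFunction N 1)⁻¹ = (partitionFunction g N)⁻¹ := by
    rw [PowerSeries.eq_inv_iff_mul_eq_one
      (by rw [constantCoeff_partitionFunction g hN]; exact one_ne_zero),
      partitionFunction_eq_specialize g hN, ← map_mul, mul_comm,
      generatingFunction_one_mul_inv hN, map_one]
  have hT : correlation g N (fun M => (gram M ^ p).trace) =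
      specialize g (generatingFunction N (genericTrace N p)) := by
    rw [← correlation_eval g hN]
    simp only [eval_genericTrace]
  rw [resolventCoeff, onePoint, ← MvPowerSeries.smul_eq_C_mul, map_smul, map_mul, hZ, hT]

theorem tendsto_resolventCoeff (g : ℕ → ℂ) (p : ℕ) :
    Tendsto (fun N => resolventCoeff g N p) atTop (𝓝 (specialize g (planarOnePoint p))) := by
  rw [PowerSeries.WithPiTopology.tendsto_iff_coeff_tendsto]
  intro s
  rw [coeff_specialize]
  refine (tendsto_finsetSum _ fun m _ => (tendsto_coeff_onePoint p m).mul_const _).congr' ?_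
  filter_upwards [eventually_gt_atTop 0] with N hN
  rw [resolventCoeff_eq_specialize g hN, coeff_specialize]

end MatrixModel

/-- Formal power series in `α` carry the topology of coefficientwise convergence; `PowerSeries.X` is
the variable `α`. -/
theorem mainTheorem1 (g : ℕ → ℂ) :
    -- all the integrals converge and the partition function is invertible
    (∀ N : ℕ, 0 < N →
      (∀ p s : ℕ, Integrable
        (fun M : MatrixModel.Entries N =>
          (MatrixModel.gram M ^ p).trace * PowerSeries.coeff s (MatrixModel.weight g M))
        (MatrixModel.gaussian N)) ∧
      PowerSeries.constantCoeff (MatrixModel.partitionFunction g N) = 1) ∧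
    -- the large `N` limits exist and satisfy the equations
    ∃ d : ℕ → PowerSeries ℂ,
      (∀ p : ℕ, Tendsto (fun N : ℕ => MatrixModel.resolventCoeff g N p) atTop (𝓝 (d p))) ∧
      d 0 = 1 ∧
      ∀ q : ℕ,
        Summable (fun n : ℕ =>
          PowerSeries.C (g (n + 1)) * PowerSeries.X ^ (n + 1) * d (q + (n + 1))) ∧
        d (q + 1) = ∑ k ∈ Finset.range (q + 1), d k * d (q - k) +
          ∑' n : ℕ, PowerSeries.C (g (n + 1)) * PowerSeries.X ^ (n + 1) * d (q + (n + 1)) := by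
  refine ⟨fun N hN => ⟨fun p s => ?_, MatrixModel.constantCoeff_partitionFunction g hN⟩,
    fun p => MatrixModel.specialize g (MatrixModel.planarOnePoint p),
    MatrixModel.tendsto_resolventCoeff g, ?_, fun q => ?_⟩
  · simp only [← MatrixModel.eval_genericTrace]
    exact MatrixModel.integrable_eval_mul_coeff_weight g hN _ s
  · simp only [MatrixModel.planarOnePoint_zero, map_one]
  · have h := MatrixModel.hasSum_coupling_mul_specialize g fun i =>
      MatrixModel.planarOnePoint (q + (i + 1))
    refine ⟨h.summable, ?_⟩
    refine Eq.trans ?_ (congrArg _ h.tsum_eq.symm)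
    beta_reduce
    rw [MatrixModel.planarOnePoint_succ]
    simp only [map_add, map_sum, map_mul]
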